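/- Let $\mathbb{C}[x_1,\ldots,x_n]_3$ be the space of complex homogeneous polynomials of degree $3$ in $n$ variables, with the Euclidean topology of a finite-dimensional complex vector space, and let $\langle u,v\rangle=\sum_{i=1}^n u_iv_i$ be the standard (non-Hermitian) bilinear form on $\mathbb{C}^n$. A symmetric tensor $T\in\mathbb{C}^{n\times n\times n}$ is identified with the cubic form $\sum_{i,j,k=1}^n T_{ijk}x_ix_jx_k$. Let $\mathrm{OW}_n(\mathbb{C})$ be the set of all $f\in\mathbb{C}[x_1,\ldots,x_n]_3$ that can be written as $f(x)=g(Ax)$, where $A\in M_n(\mathbb{C})$ satisfies $A^TA=\mathrm{Id}_n$ and $g=\alpha_1x_1^3+\cdots+\alpha_nx_n^3$ with $\alpha_1,\ldots,\alpha_n\in\mathbb{C}$. Let $\mathrm{SODECO}_n(\mathbb{C})$ be the set of all symmetric tensors of order $3$ (equivalently, of the corresponding cubic forms) that can be written as $\sum_{i=1}^k v_i^{\otimes 3}$, where $k\ge 0$ and $v_1,\ldots,v_k\in\mathbb{C}^n$ are linearly independent and pairwise orthogonal, i.e. $\langle v_i,v_j\rangle=0$ for $i\neq j$. **Theorem.**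 For every $n\ge 1$, $$\mathrm{OW}_n(\mathbb{C})\subseteq\mathrm{SODECO}_n(\mathbb{C})\subseteq\overline{\mathrm{OW}_n(\mathbb{C})},$$ and both inclusions are strict for every $n\ge 2$. More precisely, for every $n\ge 2$, the polynomial $(x_1+ix_2)^3$, viewed as a polynomial in $x_1,\ldots,x_n$, belongs to $\mathrm{SODECO}_n(\mathbb{C})$ but not to $\mathrm{OW}_n(\mathbb{C})$, and the polynomial $x_2(x_1+ix_2)^2$ belongs to $\overline{\mathrm{OW}_n(\mathbb{C})}$ but not to $\mathrm{SODECO}_n(\mathbb{C})$. -/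

import Mathlib

open Matrix

/-- The space `ℂ[x₁,…,xₙ]₃` of homogeneous polynomials of degree 3 in `n` variables. -/
abbrev CubicForm (n : ℕ) : Type :=
  ↥(MvPolynomial.homogeneousSubmodule (Fin n) ℂ 3)

/-- The Euclidean topology of the finite-dimensional complex vector space of cubic forms:
the topology of convergence of each coefficient. -/
noncomputable abbrev CubicForm.euclideanTopology (n : ℕ) : TopologicalSpace (CubicForm n) :=
  TopologicalSpace.induced
    (fun (f : CubicForm n) (m : Fin n →₀ ℕ) => MvPolynomial.coeff m (f : MvPolynomial (Fin n) ℂ))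
    (Pi.topologicalSpace (t₂ := fun _ => inferInstanceAs (TopologicalSpace ℂ)))

/-- The polynomial `g(Ax)` obtained from `g` by the linear substitution
`xᵢ ↦ ∑ⱼ Aᵢⱼ xⱼ`. -/
noncomputable def linearSubst {n : ℕ} (A : Matrix (Fin n) (Fin n) ℂ)
    (g : MvPolynomial (Fin n) ℂ) : MvPolynomial (Fin n) ℂ :=
  MvPolynomial.bind₁ (fun i => ∑ j, MvPolynomial.C (A i j) * MvPolynomial.X j) g

/-- The cubic forms `f` that admit an orthogonal Waring decomposition: `f(x) = g(Ax)` with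
`A` a complex orthogonal matrix (transpose, not conjugate transpose) and
`g = α₁x₁³ + ⋯ + αₙxₙ³`. -/
def OW (n : ℕ) : Set (CubicForm n) :=
  {f | ∃ A : Matrix (Fin n) (Fin n) ℂ, Aᵀ * A = 1 ∧ ∃ α : Fin n → ℂ,
    (f : MvPolynomial (Fin n) ℂ) =
      linearSubst A (∑ i, MvPolynomial.C (α i) * MvPolynomial.X i ^ 3)}

/-- The closure of `OW n` in the space of cubic forms, for the Euclidean topology. -/
def OWClosure (n : ℕ) : Set (CubicForm n) :=
  @closure (CubicForm n) (CubicForm.euclideanTopology n) (OW n)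

/-- Tensors of order 3 and format `n × n × n`. -/
abbrev Tensor3 (n : ℕ) : Type := Fin n → Fin n → Fin n → ℂ

/-- Invariance under all permutations of the three indices (two transpositions generate). -/
def Tensor3.IsSymmetric {n : ℕ} (T : Tensor3 n) : Prop :=
  ∀ i j k, T i j k = T j i k ∧ T i j k = T i k j

/-- The rank one symmetric tensor `v ⊗ v ⊗ v`. -/
def Tensor3.cube {n : ℕ} (v : Fin n → ℂ) : Tensor3 n :=
  fun i j k => v i * v j * v k

/-- The polynomial `∑ T_{ijk} xᵢ xⱼ xₖ` associated to a tensor. -/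
noncomputable def Tensor3.toPolynomial {n : ℕ} (T : Tensor3 n) : MvPolynomial (Fin n) ℂ :=
  ∑ i, ∑ j, ∑ k, MvPolynomial.C (T i j k) *
    (MvPolynomial.X i * MvPolynomial.X j * MvPolynomial.X k)

/-- The symmetric tensors that are sums `∑ vᵢ^{⊗3}` with `v₁,…,v_k` (`k ≥ 0`) linearly independent
and pairwise orthogonal for the bilinear form `⟨x,y⟩ = ∑ xᵢyᵢ` on `ℂⁿ`. -/
def SODECOTensor (n : ℕ) : Set (Tensor3 n) :=
  {T | T.IsSymmetric ∧ ∃ (k : ℕ) (v : Fin k → Fin n → ℂ),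
    LinearIndependent ℂ v ∧ (Pairwise fun a b => v a ⬝ᵥ v b = 0) ∧
    T = ∑ a, Tensor3.cube (v a)}

/-- The cubic forms that correspond to the tensors in `SODECOTensor n`. -/
def SODECO (n : ℕ) : Set (CubicForm n) :=
  {f | ∃ T ∈ SODECOTensor n, (f : MvPolynomial (Fin n) ℂ) = T.toPolynomial}

/-! Everything is read off from the bilinear Gram matrix. Cube roots of the coefficients turn an
orthogonal Waring form into a sum of cubes. Conversely, nonisotropic orthogonal vectors can be
normalized and completed to an orthogonal matrix (`mem_OW_of_orthogonal`), so only isotropic vectors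
separate the two sets. These lie in the radical of the span, and a dual family moves them to
nonisotropic vectors without spoiling orthogonality (`exists_nonisotropic_perturbation`); this gives
the second inclusion.

Strictness comes from polarization. For `u` isotropic, contracting `u³` with the rows of an
orthogonal matrix forces `u = 0`. For `b u²`, one slice has a nontrivial Jordan block, whereas
slices of a sum of orthogonal cubes are diagonal on the span of the vectors. Yet `b u²` is a limit
of combinations of the cubes of `u ± εs`. -/

open MvPolynomial in
theorem eval_linearSubst {n : ℕ} (A : Matrix (Fin n) (Fin n) ℂ) (α x : Fin n → ℂ) :
    eval x (linearSubst A (∑ i, C (α i) * X i ^ 3)) = ∑ i, α i * (A i ⬝ᵥ x) ^ 3 := by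
  simp [linearSubst, dotProduct]

theorem Tensor3.eval_toPolynomial {n : ℕ} (T : Tensor3 n) (x : Fin n → ℂ) :
    MvPolynomial.eval x T.toPolynomial = ∑ i, ∑ j, ∑ k, T i j k * (x i * x j * x k) := by
  simp [Tensor3.toPolynomial]

theorem sum_mul_mul_eq_dotProduct {n : ℕ} (a b c x y z : Fin n → ℂ) :
    ∑ i, ∑ j, ∑ k, a i * b j * c k * (x i * y j * z k) =
      (a ⬝ᵥ x) * (b ⬝ᵥ y) * (c ⬝ᵥ z) := by
  simp only [dotProduct]
  rw [Finset.sum_mul_sum, Finset.sum_mul]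
  refine Finset.sum_congr rfl fun i _ => ?_
  rw [Finset.sum_mul]
  refine Finset.sum_congr rfl fun j _ => ?_
  rw [Finset.mul_sum]
  exact Finset.sum_congr rfl fun k _ => by ring

theorem Tensor3.eval_toPolynomial_sum_cube {n k : ℕ} (v : Fin k → Fin n → ℂ) (x : Fin n → ℂ) :
    MvPolynomial.eval x (∑ a, Tensor3.cube (v a)).toPolynomial = ∑ a, (v a ⬝ᵥ x) ^ 3 := by
  rw [Tensor3.eval_toPolynomial]
  have h : ∀ a, (v a ⬝ᵥ x) ^ 3 =
      ∑ i, ∑ j, ∑ l, v a i * v a j * v a l * (x i * x j * x l) := fun a => by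
    rw [sum_mul_mul_eq_dotProduct]; ring
  simp only [h, Finset.sum_apply, Tensor3.cube, Finset.sum_mul]
  symm
  rw [Finset.sum_comm]
  refine Finset.sum_congr rfl fun i _ => ?_
  rw [Finset.sum_comm]
  refine Finset.sum_congr rfl fun j _ => ?_
  rw [Finset.sum_comm]

theorem Tensor3.isHomogeneous_toPolynomial {n : ℕ} (T : Tensor3 n) :
    T.toPolynomial ∈ MvPolynomial.homogeneousSubmodule (Fin n) ℂ 3 := by
  refine Submodule.sum_mem _ fun i _ => Submodule.sum_mem _ fun j _ =>
    Submodule.sum_mem _ fun k _ => ?_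
  rw [← MvPolynomial.smul_eq_C_mul]
  exact Submodule.smul_mem _ _ (((MvPolynomial.isHomogeneous_X ℂ i).mul
    (MvPolynomial.isHomogeneous_X ℂ j)).mul (MvPolynomial.isHomogeneous_X ℂ k))

/-- The cubic form attached to a tensor. -/
noncomputable def Tensor3.toCubicForm {n : ℕ} (T : Tensor3 n) : CubicForm n :=
  ⟨T.toPolynomial, T.isHomogeneous_toPolynomial⟩

/-- Over an infinite field a polynomial is determined by its values, so evaluations suffice. -/
theorem mem_OW_iff {n : ℕ} {f : CubicForm n} :
    f ∈ OW n ↔ ∃ A : Matrix (Fin n) (Fin n) ℂ, Aᵀ * A = 1 ∧ ∃ α : Fin n → ℂ,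
      ∀ x, MvPolynomial.eval x (f : MvPolynomial (Fin n) ℂ) = ∑ i, α i * (A i ⬝ᵥ x) ^ 3 := by
  constructor
  · rintro ⟨A, hA, α, h⟩
    exact ⟨A, hA, α, fun x => by rw [h, eval_linearSubst]⟩
  · rintro ⟨A, hA, α, h⟩
    exact ⟨A, hA, α, MvPolynomial.funext fun x => by rw [h, eval_linearSubst]⟩

theorem Tensor3.isSymmetric_sum_cube {n k : ℕ} (v : Fin k → Fin n → ℂ) :
    (∑ a, Tensor3.cube (v a)).IsSymmetric := by
  intro i j l
  simp only [Finset.sum_apply, Tensor3.cube]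
  exact ⟨Finset.sum_congr rfl fun a _ => by ring, Finset.sum_congr rfl fun a _ => by ring⟩

theorem mem_SODECO_iff {n : ℕ} {f : CubicForm n} :
    f ∈ SODECO n ↔ ∃ (k : ℕ) (v : Fin k → Fin n → ℂ), LinearIndependent ℂ v ∧
      (Pairwise fun a b => v a ⬝ᵥ v b = 0) ∧
      ∀ x, MvPolynomial.eval x (f : MvPolynomial (Fin n) ℂ) = ∑ a, (v a ⬝ᵥ x) ^ 3 := by
  constructor
  · rintro ⟨T, ⟨-, k, v, hv, hp, rfl⟩, h⟩
    exact ⟨k, v, hv, hp, fun x => by rw [h, Tensor3.eval_toPolynomial_sum_cube]⟩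
  · rintro ⟨k, v, hv, hp, h⟩
    exact ⟨_, ⟨Tensor3.isSymmetric_sum_cube v, k, v, hv, hp, rfl⟩, MvPolynomial.funext fun x => by
      rw [h, Tensor3.eval_toPolynomial_sum_cube]⟩

/-- A cubic form that is a limit, along a continuous family of tensors, of elements of `OW n`
lies in the closure. -/
theorem mem_OWClosure_of_continuous {n : ℕ} {f : CubicForm n} (T : ℂ → Tensor3 n)
    (hT : ∀ i j k, Continuous fun ε => T ε i j k)
    (h0 : ∀ x, MvPolynomial.eval x (f : MvPolynomial (Fin n) ℂ) =
      MvPolynomial.eval x (T 0).toPolynomial)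
    (h : ∀ ε ≠ 0, (T ε).toCubicForm ∈ OW n) : f ∈ OWClosure n := by
  let _ := CubicForm.euclideanTopology n
  have hf : f = (T 0).toCubicForm := Subtype.ext (MvPolynomial.funext h0)
  have hc : Continuous fun ε => (T ε).toCubicForm := by
    refine continuous_induced_rng.2 (continuous_pi fun m => ?_)
    simp only [Function.comp_def, Tensor3.toCubicForm, Tensor3.toPolynomial,
      MvPolynomial.coeff_sum, MvPolynomial.coeff_C_mul]
    exact continuous_finsetSum _ fun i _ => continuous_finsetSum _ fun j _ =>
      continuous_finsetSum _ fun k _ => (hT i j k).mul continuous_const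
  have ht : Filter.Tendsto (fun ε => (T ε).toCubicForm) (nhdsWithin 0 {0}ᶜ) (nhds f) :=
    hf ▸ (hc.tendsto 0).mono_left nhdsWithin_le_nhds
  exact mem_closure_of_tendsto ht (eventually_nhdsWithin_of_forall h)

/-! ### Completing orthonormal families -/

theorem eq_zero_of_forall_dotProduct {n : ℕ} {u : Fin n → ℂ} (h : ∀ y, u ⬝ᵥ y = 0) : u = 0 :=
  dotProduct_eq_zero_iff.1 h

/-- An orthonormal family (for the bilinear dot product) with fewer than `n` members can be
enlarged. -/
theorem exists_dotProduct_self_eq_one_orthogonal {n k : ℕ} (hk : k < n) (e : Fin k → Fin n → ℂ)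
    (he : ∀ a b, e a ⬝ᵥ e b = if a = b then 1 else 0) :
    ∃ z : Fin n → ℂ, z ⬝ᵥ z = 1 ∧ ∀ a, e a ⬝ᵥ z = 0 := by
  suffices h : ∃ z : Fin n → ℂ, z ⬝ᵥ z ≠ 0 ∧ ∀ a, e a ⬝ᵥ z = 0 by
    obtain ⟨z, hz, hez⟩ := h
    obtain ⟨r, hr⟩ := IsAlgClosed.exists_pow_nat_eq (z ⬝ᵥ z) (n := 2) (by norm_num)
    have hr0 : r ≠ 0 := by rintro rfl; exact hz (by rw [← hr]; norm_num)
    refine ⟨r⁻¹ • z, ?_, fun a => by simp [hez a]⟩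
    simp only [smul_dotProduct, dotProduct_smul, smul_eq_mul, ← hr]
    field_simp
  obtain ⟨x, hx, hx0⟩ : ∃ x : Fin n → ℂ, x ∈ LinearMap.ker (Matrix.mulVecLin (Matrix.of e)) ∧
      x ≠ 0 := by
    refine Submodule.exists_mem_ne_zero_of_ne_bot
      (LinearMap.ker_ne_bot_of_finrank_lt (by simpa using hk))
  have hex : ∀ a, e a ⬝ᵥ x = 0 := fun a => congrFun hx a
  obtain ⟨y, hy⟩ : ∃ y, x ⬝ᵥ y ≠ 0 := by
    by_contra! h
    exact hx0 (eq_zero_of_forall_dotProduct h)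
  -- Projecting `y` off the family keeps `x ⬝ᵥ y`, since `x` is orthogonal to every `e a`.
  let z := y - ∑ a, (e a ⬝ᵥ y) • e a
  have hez : ∀ a, e a ⬝ᵥ z = 0 := fun a => by
    simp [z, dotProduct_sub, dotProduct_sum, he]
  have hxz : x ⬝ᵥ z ≠ 0 := by
    have : x ⬝ᵥ z = x ⬝ᵥ y := by
      simp [z, dotProduct_sub, dotProduct_sum, fun a => (dotProduct_comm x (e a)).trans (hex a)]
    rwa [this]
  -- One of `x`, `z`, `x + z` is nonisotropic: if the first two are isotropic, the third has square
  -- `2 (x ⬝ᵥ z) ≠ 0`.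
  by_contra! h
  have h1 : x ⬝ᵥ x = 0 := by
    by_contra h'
    obtain ⟨a, ha⟩ := h x h'
    exact ha (hex a)
  have h2 : z ⬝ᵥ z = 0 := by
    by_contra h'
    obtain ⟨a, ha⟩ := h z h'
    exact ha (hez a)
  have h3 : (x + z) ⬝ᵥ (x + z) ≠ 0 := by
    rw [add_dotProduct, dotProduct_add, dotProduct_add, h1, h2, dotProduct_comm z x]
    simpa using hxz
  obtain ⟨a, ha⟩ := h _ h3
  exact ha (by rw [dotProduct_add, hex, hez, add_zero])

/-- Induction on the number `m` of missing rows. New vectors are prepended, so `σ` tracks where the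
original ones end up. -/
theorem exists_orthogonal_matrix_extending {n : ℕ} (m : ℕ) : ∀ {k : ℕ}, k + m = n →
    ∀ e : Fin k → Fin n → ℂ, (∀ a b, e a ⬝ᵥ e b = if a = b then 1 else 0) →
    ∃ (A : Matrix (Fin n) (Fin n) ℂ) (σ : Fin k → Fin n), A * Aᵀ = 1 ∧ ∀ a, A (σ a) = e a := by
  induction m with
  | zero =>
    rintro k rfl e he
    refine ⟨Matrix.of e, id, ?_, fun a => rfl⟩
    ext a b
    rw [Matrix.mul_apply', Matrix.one_apply]
    exact he a b
  | succ m ih =>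
    intro k hk e he
    obtain ⟨z, hz, hez⟩ := exists_dotProduct_self_eq_one_orthogonal (by omega) e he
    obtain ⟨A, σ, hA, hσ⟩ := ih (k := k + 1) (by omega) (Fin.cons z e) (by
      intro a b
      refine Fin.cases ?_ (fun a => ?_) a <;> refine Fin.cases ?_ (fun b => ?_) b
      · simpa using hz
      · simpa [(Fin.succ_ne_zero b).symm] using (dotProduct_comm _ _).trans (hez b)
      · simpa using hez a
      · simpa using he a b)
    exact ⟨A, fun a => σ a.succ, hA, fun a => by simp [hσ]⟩

/-- Combinations of cubes of pairwise orthogonal nonisotropic linear forms lie in `OW n`. -/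
theorem mem_OW_of_orthogonal {n k : ℕ} {f : CubicForm n} (p : Fin k → Fin n → ℂ)
    (hp : Pairwise fun a b => p a ⬝ᵥ p b = 0) (hp0 : ∀ a, p a ⬝ᵥ p a ≠ 0) (β : Fin k → ℂ)
    (hf : ∀ x, MvPolynomial.eval x (f : MvPolynomial (Fin n) ℂ) = ∑ a, β a * (p a ⬝ᵥ x) ^ 3) :
    f ∈ OW n := by
  choose r hr using fun a => IsAlgClosed.exists_pow_nat_eq (p a ⬝ᵥ p a) (n := 2) (by norm_num)
  have hr0 : ∀ a, r a ≠ 0 := fun a h => hp0 a (by rw [← hr, h]; norm_num)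
  have he : ∀ a b, ((r a)⁻¹ • p a) ⬝ᵥ ((r b)⁻¹ • p b) = if a = b then 1 else 0 := by
    intro a b
    split_ifs with h
    · subst h
      have := hr0 a
      simp only [smul_dotProduct, dotProduct_smul, smul_eq_mul, ← hr]
      field_simp
    · simp [hp h]
  have hk : k ≤ n := by
    have hli : LinearIndependent ℂ fun a => (r a)⁻¹ • p a := by
      rw [Fintype.linearIndependent_iff]
      intro g hg a
      have := congrArg (fun y => ((r a)⁻¹ • p a) ⬝ᵥ y) hg
      simp only [dotProduct_sum, dotProduct_zero] at this
      rw [Finset.sum_congr rfl fun b _ => (dotProduct_smul (g b) _ _).trans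
        (congrArg (g b • ·) (he a b))] at this
      simpa using this
    simpa using hli.fintype_card_le_finrank
  obtain ⟨A, σ, hA, hσ⟩ := exists_orthogonal_matrix_extending (n - k) (by omega) _ he
  have hinj : Function.Injective σ := by
    intro a b h
    by_contra hab
    have h1 := he a b
    rw [if_neg hab, ← hσ a, h, hσ b, he b b, if_pos rfl] at h1
    exact one_ne_zero h1
  -- The factor `r a ^ 3` undoes the normalization; the added rows get coefficient 0.
  refine mem_OW_iff.2 ⟨A, mul_eq_one_comm.1 hA,
    Function.extend σ (fun a => β a * r a ^ 3) 0, fun x => ?_⟩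
  rw [hf]
  refine Finset.sum_of_injOn σ hinj.injOn (by simp) (fun i _ hi => ?_) fun a _ => ?_
  · rw [Function.extend_apply' _ _ _ (by simpa using hi)]
    simp
  · have := hr0 a
    rw [hinj.extend_apply, hσ, smul_dotProduct, smul_eq_mul]
    field_simp

/-! ### The two inclusions -/

theorem OW_subset_SODECO (n : ℕ) : OW n ⊆ SODECO n := by
  intro f hf
  obtain ⟨A, hA, α, h⟩ := mem_OW_iff.1 hf
  have hA' : A * Aᵀ = 1 := mul_eq_one_comm.1 hA
  have hd : ∀ i j, A i ⬝ᵥ A j = if i = j then 1 else 0 := fun i j => by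
    rw [← Matrix.one_apply, ← hA', Matrix.mul_apply']
    rfl
  choose r hr using fun i => IsAlgClosed.exists_pow_nat_eq (α i) (n := 3) (by norm_num)
  -- Rows with zero coefficient are dropped, as they would give zero vectors and break independence.
  let S := {i : Fin n // α i ≠ 0}
  let φ : Fin (Fintype.card S) ≃ S := (Fintype.equivFin S).symm
  refine mem_SODECO_iff.2 ⟨_, fun a => r (φ a) • A (φ a), ?_, fun a b hab => ?_, fun x => ?_⟩
  · rw [Fintype.linearIndependent_iff]
    intro g hg a
    have h1 := congrArg (fun y => A (φ a) ⬝ᵥ y) hg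
    have h2 : r (φ a) ≠ 0 := fun h0 => (φ a).2 (by rw [← hr, h0]; norm_num)
    simp only [dotProduct_sum, dotProduct_smul, hd, Subtype.coe_inj, φ.injective.eq_iff] at h1
    simpa [h2] using h1
  · have : (φ a : Fin n) ≠ φ b := fun h => hab (φ.injective (Subtype.ext h))
    simp [hd, this]
  · rw [h]
    symm
    refine Finset.sum_of_injOn (fun a => (φ a : Fin n))
      (Subtype.val_injective.comp φ.injective).injOn (by simp) (fun i _ hi => ?_) fun a _ => ?_
    · have : α i = 0 := by
        by_contra h0
        exact hi ⟨φ.symm ⟨i, h0⟩, by simp, by simp⟩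
      simp [this]
    · rw [smul_dotProduct, smul_eq_mul, mul_pow, hr]

/-- The matrix with rows `v a` has full row rank, hence is surjective; `w b` is a preimage of the
`b`-th basis vector. -/
theorem exists_dual_family {n k : ℕ} {v : Fin k → Fin n → ℂ} (hv : LinearIndependent ℂ v) :
    ∃ w : Fin k → Fin n → ℂ, ∀ a b, v a ⬝ᵥ w b = if a = b then 1 else 0 := by
  have hV : Function.Surjective (Matrix.of v).mulVec := by
    rw [← Matrix.coe_mulVecLin, ← LinearMap.range_eq_top]
    apply Submodule.eq_top_of_finrank_eq
    have := LinearIndependent.rank_matrix (M := Matrix.of v) hv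
    simpa [Matrix.rank] using this
  choose w hw using fun b => hV (Pi.single b 1)
  refine ⟨w, fun a b => ?_⟩
  have := congrFun (hw b) a
  rw [Pi.single_apply] at this
  exact this

/-- Pairwise orthogonal linearly independent vectors can be moved, linearly in a parameter, to
pairwise orthogonal nonisotropic ones. -/
theorem exists_nonisotropic_perturbation {n k : ℕ} {v : Fin k → Fin n → ℂ}
    (hv : LinearIndependent ℂ v) (hp : Pairwise fun a b => v a ⬝ᵥ v b = 0) :
    ∃ w : Fin k → Fin n → ℂ, ∀ ε : ℂ, ε ≠ 0 →
      (Pairwise fun a b => (v a + ε • w a) ⬝ᵥ (v b + ε • w b) = 0) ∧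
      ∀ a, (v a + ε • w a) ⬝ᵥ (v a + ε • w a) ≠ 0 := by
  classical
  obtain ⟨w, hw⟩ := exists_dual_family hv
  -- Only the isotropic vectors are moved; `c` is their indicator.
  let c : Fin k → ℂ := fun a => if v a ⬝ᵥ v a = 0 then 1 else 0
  have hcc : ∀ a, c a * c a = c a := fun a => by simp [c]
  have hvc : ∀ a b, c b * (v a ⬝ᵥ v b) = 0 := by
    intro a b
    by_cases h : a = b
    · subst h
      simp [c]
    · simp [hp h]
  -- `q a` lies in the span of the isotropic `v b`, so it is orthogonal to every `v d`. Subtracting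
  -- half of it from `w a` keeps the duality and cancels the products `w a ⬝ᵥ w b` between moved
  -- indices.
  let q : Fin k → Fin n → ℂ := fun a => ∑ b, (c b * (w a ⬝ᵥ w b)) • v b
  have hvq : ∀ a b, v a ⬝ᵥ q b = 0 := fun a b => by
    simp only [q, dotProduct_sum, dotProduct_smul, smul_eq_mul]
    exact Finset.sum_eq_zero fun d _ => by linear_combination (w b ⬝ᵥ w d) * hvc a d
  have hwq : ∀ a b, w a ⬝ᵥ q b = c a * (w a ⬝ᵥ w b) := fun a b => by
    simp [q, dotProduct_sum, dotProduct_comm (w a) (v _), hw, dotProduct_comm (w b) (w a)]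
  have hqq : ∀ a b, q a ⬝ᵥ q b = 0 := fun a b => by
    conv_lhs => enter [1]; simp only [q]
    simp [sum_dotProduct, hvq]
  let p : Fin k → Fin n → ℂ := fun a => c a • (w a - (1 / 2 : ℂ) • q a)
  have hvp : ∀ a b, v a ⬝ᵥ p b = c b * if a = b then 1 else 0 := fun a b => by
    simp [p, dotProduct_sub, hvq, hw]
  have hpp : ∀ a b, p a ⬝ᵥ p b = 0 := fun a b => by
    simp only [p, smul_dotProduct, dotProduct_smul, sub_dotProduct, dotProduct_sub, hqq, hwq,
      dotProduct_comm (q a) (w b), smul_eq_mul, dotProduct_comm (w b) (w a)]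
    linear_combination (-1 / 2 * c b * (w a ⬝ᵥ w b)) * hcc a
      - 1 / 2 * c a * (w a ⬝ᵥ w b) * hcc b
  -- The perturbed Gram matrix is diagonal, with entries `v a ⬝ᵥ v a + 2 ε c a`.
  have key : ∀ (ε : ℂ) (a b), (v a + ε • p a) ⬝ᵥ (v b + ε • p b) =
      v a ⬝ᵥ v b + ε * (c b + c a) * if a = b then 1 else 0 := fun ε a b => by
    simp only [add_dotProduct, dotProduct_add, smul_dotProduct, dotProduct_smul, hpp, hvp,
      dotProduct_comm (p a) (v b), smul_eq_mul, eq_comm (a := b)]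
    ring
  refine ⟨p, fun ε hε => ⟨fun a b hab => ?_, fun a => ?_⟩⟩
  · refine (key ε a b).trans ?_
    rw [hp hab, if_neg hab]
    ring
  · rw [key, if_pos rfl]
    by_cases h : v a ⬝ᵥ v a = 0
    · simpa [c, h] using hε
    · simp [c, h]

theorem SODECO_subset_OWClosure (n : ℕ) : SODECO n ⊆ OWClosure n := by
  intro f hf
  obtain ⟨k, v, hv, hp, h⟩ := mem_SODECO_iff.1 hf
  obtain ⟨w, hw⟩ := exists_nonisotropic_perturbation hv hp
  refine mem_OWClosure_of_continuous (fun ε => ∑ a, Tensor3.cube (v a + ε • w a))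
    (fun i j l => ?_) (fun x => ?_) fun ε hε => ?_
  · simp only [Finset.sum_apply, Tensor3.cube, Pi.add_apply, Pi.smul_apply, smul_eq_mul]
    fun_prop
  · rw [h, Tensor3.eval_toPolynomial_sum_cube]
    simp
  · refine mem_OW_of_orthogonal _ (hw ε hε).1 (hw ε hε).2 (fun _ => 1) fun x => ?_
    simp only [one_mul]
    exact Tensor3.eval_toPolynomial_sum_cube _ x

/-! ### Strictness of the inclusions -/

/-- Polarization of an identity between sums of products of three linear forms. -/
theorem polarization {n : ℕ} {ι : Type*} [Fintype ι] (β : ι → ℂ) (v : ι → Fin n → ℂ)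
    (a b : Fin n → ℂ)
    (h : ∀ x, ∑ i, β i * (v i ⬝ᵥ x) ^ 3 = (a ⬝ᵥ x) * (b ⬝ᵥ x) ^ 2) (x y z : Fin n → ℂ) :
    3 * ∑ i, β i * ((v i ⬝ᵥ x) * (v i ⬝ᵥ y) * (v i ⬝ᵥ z)) =
      (a ⬝ᵥ x) * (b ⬝ᵥ y) * (b ⬝ᵥ z) + (b ⬝ᵥ x) * (a ⬝ᵥ y) * (b ⬝ᵥ z) +
        (b ⬝ᵥ x) * (b ⬝ᵥ y) * (a ⬝ᵥ z) := by
  have h6 : ∑ i, β i * (v i ⬝ᵥ (x + y + z)) ^ 3 - ∑ i, β i * (v i ⬝ᵥ (x + y)) ^ 3 -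
      ∑ i, β i * (v i ⬝ᵥ (x + z)) ^ 3 - ∑ i, β i * (v i ⬝ᵥ (y + z)) ^ 3 +
      ∑ i, β i * (v i ⬝ᵥ x) ^ 3 + ∑ i, β i * (v i ⬝ᵥ y) ^ 3 + ∑ i, β i * (v i ⬝ᵥ z) ^ 3 =
      6 * ∑ i, β i * ((v i ⬝ᵥ x) * (v i ⬝ᵥ y) * (v i ⬝ᵥ z)) := by
    simp only [← Finset.sum_sub_distrib, ← Finset.sum_add_distrib, Finset.mul_sum]
    refine Finset.sum_congr rfl fun i _ => ?_
    simp only [dotProduct_add]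
    ring
  simp only [h] at h6
  simp only [dotProduct_add] at h6
  linear_combination (-1 / 2 : ℂ) * h6

/-- The cube of a nonzero isotropic linear form is not in `OW n`. -/
theorem isotropic_cube_notMem_OW {n : ℕ} {f : CubicForm n} {u : Fin n → ℂ} (hu : u ⬝ᵥ u = 0)
    (hu0 : u ≠ 0)
    (hf : ∀ x, MvPolynomial.eval x (f : MvPolynomial (Fin n) ℂ) = (u ⬝ᵥ x) ^ 3) : f ∉ OW n := by
  intro hmem
  obtain ⟨A, hA, α, h⟩ := mem_OW_iff.1 hmem
  have hd : ∀ i j, A i ⬝ᵥ A j = if i = j then 1 else 0 := fun i j => by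
    rw [← Matrix.one_apply, ← mul_eq_one_comm.1 hA, Matrix.mul_apply']
    rfl
  have hpol := polarization α A u u fun x => by rw [← h, hf]; ring
  -- The two contractions give `α i = (A i ⬝ᵥ u) ^ 3` and `α i * (A i ⬝ᵥ u) = 0`.
  have hA0 : A *ᵥ u = 0 := by
    ext i
    have h1 := hpol (A i) (A i) (A i)
    have h2 := hpol (A i) (A i) u
    simp only [hd, hu, ite_mul, mul_ite, one_mul, mul_one, mul_zero, zero_mul,
      Finset.sum_ite_eq', Finset.mem_univ,
      if_true] at h1 h2
    have h3 : (A i ⬝ᵥ u) ^ 4 = 0 := by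
      rw [dotProduct_comm u] at h1
      linear_combination (-1 / 3 * (A i ⬝ᵥ u)) * h1 + 1 / 3 * h2
    exact pow_eq_zero_iff (by norm_num) |>.1 h3
  apply hu0
  rw [← Matrix.one_mulVec u, ← hA, ← Matrix.mulVec_mulVec, hA0, Matrix.mulVec_zero]

/-- If `u` is isotropic and not orthogonal to `b`, then `b u²` is a limit of elements of `OW n`. -/
theorem mul_isotropic_sq_mem_OWClosure {n : ℕ} {f : CubicForm n} {b u : Fin n → ℂ}
    (hu : u ⬝ᵥ u = 0) (hub : u ⬝ᵥ b ≠ 0)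
    (hf : ∀ x, MvPolynomial.eval x (f : MvPolynomial (Fin n) ℂ) = (b ⬝ᵥ x) * (u ⬝ᵥ x) ^ 2) :
    f ∈ OWClosure n := by
  -- This `c` makes `s = b + c u` isotropic. Then `u ± εs` are orthogonal, with squares `±2ε (u ⬝ᵥ
  -- b)`.
  obtain ⟨c, hc⟩ : ∃ c : ℂ, b ⬝ᵥ b + 2 * c * (u ⬝ᵥ b) = 0 :=
    ⟨-(b ⬝ᵥ b) / (2 * (u ⬝ᵥ b)), by field_simp; ring⟩
  let s := b + c • u
  have hus : u ⬝ᵥ s = u ⬝ᵥ b := by simp [s, hu]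
  have hss : s ⬝ᵥ s = 0 := by
    simp only [s, add_dotProduct, dotProduct_add, smul_dotProduct, dotProduct_smul, hu,
      dotProduct_comm b u, smul_eq_mul]
    linear_combination hc
  -- With `b = s - c u`, the difference of the cubes of `u ± εs` over `6ε` yields `s u²`, and `-c/2`
  -- times their sum yields `-c u³`; the `ε ^ 2` terms are the remainders. `T ε` need not be
  -- symmetric, since only its polynomial matters.
  let T : ℂ → Tensor3 n := fun ε i j k =>
    b i * u j * u k + ε ^ 2 * (1 / 3 * (s i * s j * s k) - 3 * c * (u i * s j * s k))
  have hT : ∀ ε x, MvPolynomial.eval x (T ε).toPolynomial = (b ⬝ᵥ x) * (u ⬝ᵥ x) ^ 2 +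
      ε ^ 2 * (1 / 3 * (s ⬝ᵥ x) ^ 3 - 3 * c * ((u ⬝ᵥ x) * (s ⬝ᵥ x) ^ 2)) := by
    intro ε x
    have h1 := sum_mul_mul_eq_dotProduct b u u x x x
    have h2 := sum_mul_mul_eq_dotProduct s s s x x x
    have h3 := sum_mul_mul_eq_dotProduct u s s x x x
    rw [Tensor3.eval_toPolynomial]
    trans (b ⬝ᵥ x) * (u ⬝ᵥ x) * (u ⬝ᵥ x) + ε ^ 2 * (1 / 3 * ((s ⬝ᵥ x) * (s ⬝ᵥ x) * (s ⬝ᵥ x)) -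
      3 * c * ((u ⬝ᵥ x) * (s ⬝ᵥ x) * (s ⬝ᵥ x)))
    · rw [← h1, ← h2, ← h3]
      simp only [Finset.mul_sum, ← Finset.sum_sub_distrib, ← Finset.sum_add_distrib]
      refine Finset.sum_congr rfl fun i _ => Finset.sum_congr rfl fun j _ =>
        Finset.sum_congr rfl fun k _ => ?_
      simp only [T]
      ring
    · ring
  refine mem_OWClosure_of_continuous T (fun i j k => ?_) (fun x => ?_) fun ε hε => ?_
  · simp only [T]
    fun_prop
  · rw [hf, hT]
    ring
  · refine mem_OW_of_orthogonal ![u + ε • s, u - ε • s] ?_ ?_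
      ![1 / (6 * ε) - c / 2, -1 / (6 * ε) - c / 2] fun x => ?_
    · intro i j hij
      fin_cases i <;> fin_cases j <;> first | exact absurd rfl hij | skip
      all_goals
        simp [hu, hss, dotProduct_comm s u]
    · have h2 : ε * (u ⬝ᵥ b) ≠ 0 := mul_ne_zero hε hub
      intro i h
      apply h2
      fin_cases i <;>
        simp only [Fin.zero_eta, Fin.mk_one, Matrix.cons_val_zero, Matrix.cons_val_one,
          add_dotProduct, sub_dotProduct, dotProduct_sub, dotProduct_add,
          smul_dotProduct, dotProduct_smul, hu, hss, dotProduct_comm s u, smul_eq_mul, hus] at h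
      · linear_combination (1 / 2 : ℂ) * h
      · linear_combination (-1 / 2 : ℂ) * h
    · refine (hT ε x).trans ?_
      have hb : b ⬝ᵥ x = s ⬝ᵥ x - c * (u ⬝ᵥ x) := by simp [s, add_dotProduct]
      simp only [Fin.sum_univ_two, Matrix.cons_val_zero, Matrix.cons_val_one, add_dotProduct,
        sub_dotProduct, smul_dotProduct, smul_eq_mul, hb]
      field_simp
      ring

/-- The form `b u²`, with `u` isotropic and `b` of a suitable shape, has no decomposition into
cubes of linearly independent pairwise orthogonal forms. -/
theorem mul_isotropic_sq_notMem_SODECO {n : ℕ} {f : CubicForm n} {b u e : Fin n → ℂ}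
    (hu : u ⬝ᵥ u = 0) (hub : u ⬝ᵥ b = Complex.I) (hbb : b ⬝ᵥ b = 1) (hue : u ⬝ᵥ e = 1)
    (hbe : b ⬝ᵥ e = 0)
    (hf : ∀ x, MvPolynomial.eval x (f : MvPolynomial (Fin n) ℂ) = (b ⬝ᵥ x) * (u ⬝ᵥ x) ^ 2) :
    f ∉ SODECO n := by
  intro hmem
  obtain ⟨k, v, hv, hp, h⟩ := mem_SODECO_iff.1 hmem
  have hpol := polarization (fun _ => 1) v b u fun x => by rw [← hf, h]; simp
  -- Both sides are `S y`, where `S` is three times the slice along `e`. Here `S e = b`, `(S - i) b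
  -- = u` and `(S - i) u = 0`.
  have hvec : ∀ y, ∑ a, (3 * (v a ⬝ᵥ e) * (v a ⬝ᵥ y)) • v a = (b ⬝ᵥ y) • u + (u ⬝ᵥ y) • b := by
    intro y
    rw [← sub_eq_zero]
    refine eq_zero_of_forall_dotProduct fun z => ?_
    have := hpol e y z
    simp only [hue, hbe, Finset.mul_sum] at this
    simp only [sub_dotProduct, sum_dotProduct, add_dotProduct, smul_dotProduct, smul_eq_mul]
    rw [sub_eq_zero]
    refine Eq.trans (Finset.sum_congr rfl fun a _ => by ring) (this.trans (by ring))
  have hdot : ∀ (g : Fin k → ℂ) (a), v a ⬝ᵥ ∑ d, g d • v d = g a * (v a ⬝ᵥ v a) := by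
    intro g a
    rw [dotProduct_sum, Finset.sum_eq_single a]
    · simp
    · intro d _ hd
      simp [hp hd.symm]
    · simp
  -- Each `v a` is an eigenvector of `S - i` with eigenvalue `l a`. As `b` lies in the span of the
  -- `v a`, `(S - i)² b = 0` forces `u = (S - i) b = 0`.
  let l : Fin k → ℂ := fun a => 3 * (v a ⬝ᵥ e) * (v a ⬝ᵥ v a) - Complex.I
  let c : Fin k → ℂ := fun a => 3 * (v a ⬝ᵥ e) * (v a ⬝ᵥ e)
  have hb : ∑ a, c a • v a = b := by
    have := hvec e
    rwa [hue, hbe, zero_smul, one_smul, zero_add] at this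
  have hu' : ∑ a, (c a * l a) • v a = u := by
    have h1 := hvec b
    rw [hub, hbb, one_smul] at h1
    rw [← add_sub_cancel_right u (Complex.I • b), ← h1, ← hb, Finset.smul_sum,
      ← Finset.sum_sub_distrib]
    refine Finset.sum_congr rfl fun a _ => ?_
    rw [hdot, smul_smul, ← sub_smul]
    congr 1
    ring
  have h0 : ∑ a, (c a * l a * l a) • v a = 0 := by
    have h1 := hvec u
    rw [hu, zero_smul, add_zero, dotProduct_comm b u, hub] at h1
    rw [← sub_self (Complex.I • u)]
    nth_rewrite 1 [← h1]
    rw [← hu', Finset.smul_sum, ← Finset.sum_sub_distrib]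
    refine Finset.sum_congr rfl fun a _ => ?_
    rw [hdot, smul_smul, ← sub_smul]
    congr 1
    ring
  have hcl : ∀ a, c a * l a = 0 := fun a => by
    have := Fintype.linearIndependent_iff.1 hv _ h0 a
    rcases mul_eq_zero.1 this with h | h
    · exact h
    · rw [h, mul_zero]
  have : u = 0 := by simp [← hu', hcl]
  rw [this, zero_dotProduct] at hue
  exact zero_ne_one hue

theorem mainTheorem3 (n : ℕ) (hn : 1 ≤ n) :
    (OW n ⊆ SODECO n ∧ SODECO n ⊆ OWClosure n) ∧
    ∀ h2 : 2 ≤ n,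
      (OW n ⊂ SODECO n ∧ SODECO n ⊂ OWClosure n) ∧
      (∃ f : CubicForm n, f ∈ SODECO n ∧ f ∉ OW n ∧
        (f : MvPolynomial (Fin n) ℂ) =
          (MvPolynomial.X (⟨0, by omega⟩ : Fin n) +
            MvPolynomial.C Complex.I * MvPolynomial.X (⟨1, by omega⟩ : Fin n)) ^ 3) ∧
      (∃ g : CubicForm n, g ∈ OWClosure n ∧ g ∉ SODECO n ∧
        (g : MvPolynomial (Fin n) ℂ) =
          MvPolynomial.X (⟨1, by omega⟩ : Fin n) *
            (MvPolynomial.X (⟨0, by omega⟩ : Fin n) +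
              MvPolynomial.C Complex.I * MvPolynomial.X (⟨1, by omega⟩ : Fin n)) ^ 2) := by
  have hmain := And.intro (OW_subset_SODECO n) (SODECO_subset_OWClosure n)
  refine ⟨hmain, fun h2 => ?_⟩
  set i0 : Fin n := ⟨0, by omega⟩ with hi0
  set i1 : Fin n := ⟨1, by omega⟩ with hi1
  have h01 : i0 ≠ i1 := by simp [hi0, hi1]
  let b : Fin n → ℂ := Pi.single i1 1
  let e : Fin n → ℂ := Pi.single i0 1
  let u : Fin n → ℂ := e + Complex.I • b
  have hee : e ⬝ᵥ e = 1 := by simp [e]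
  have hbb : b ⬝ᵥ b = 1 := by simp [b]
  have hbe : b ⬝ᵥ e = 0 := by simp [b, e, h01.symm]
  have heb : e ⬝ᵥ b = 0 := by rw [dotProduct_comm, hbe]
  have hue : u ⬝ᵥ e = 1 := by simp [u, hee, hbe]
  have hub : u ⬝ᵥ b = Complex.I := by simp [u, hbb, heb]
  have hu : u ⬝ᵥ u = 0 := by
    conv_lhs => enter [2]; simp only [u]
    simp [hue, hub]
  have hu0 : u ≠ 0 := fun h => by simp [h] at hue
  have hbx : ∀ x, b ⬝ᵥ x = x i1 := fun x => by simp [b]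
  have hux : ∀ x, u ⬝ᵥ x = x i0 + Complex.I * x i1 := fun x => by
    simp [u, e, b, add_dotProduct]
  have hlin : (MvPolynomial.X i0 + MvPolynomial.C Complex.I * MvPolynomial.X i1 :
      MvPolynomial (Fin n) ℂ).IsHomogeneous 1 := by
    refine (MvPolynomial.isHomogeneous_X ℂ i0).add ?_
    simpa using (MvPolynomial.isHomogeneous_C (Fin n) Complex.I).mul
      (MvPolynomial.isHomogeneous_X ℂ i1)
  let f : CubicForm n := ⟨_, hlin.pow 3⟩
  let g : CubicForm n := ⟨_, (MvPolynomial.isHomogeneous_X ℂ i1).mul (hlin.pow 2)⟩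
  have hf : ∀ x, MvPolynomial.eval x (f : MvPolynomial (Fin n) ℂ) = (u ⬝ᵥ x) ^ 3 := fun x => by
    simp [f, hux]
  have hg : ∀ x, MvPolynomial.eval x (g : MvPolynomial (Fin n) ℂ) =
      (b ⬝ᵥ x) * (u ⬝ᵥ x) ^ 2 := fun x => by simp [g, hux, hbx]
  have hfS : f ∈ SODECO n := mem_SODECO_iff.2 ⟨1, fun _ => u,
    LinearIndependent.of_subsingleton 0 hu0, fun a b hab => (hab (Subsingleton.elim a b)).elim,
    fun x => by simp [hf]⟩
  have hfO : f ∉ OW n := isotropic_cube_notMem_OW hu hu0 hf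
  have hgC : g ∈ OWClosure n :=
    mul_isotropic_sq_mem_OWClosure hu (by rw [hub]; exact Complex.I_ne_zero) hg
  have hgS : g ∉ SODECO n := mul_isotropic_sq_notMem_SODECO hu hub hbb hue hbe hg
  exact ⟨⟨⟨hmain.1, fun h => hfO (h hfS)⟩, ⟨hmain.2, fun h => hgS (h hgC)⟩⟩,
    ⟨f, hfS, hfO, rfl⟩, ⟨g, hgC, hgS, rfl⟩⟩
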